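/- **Setting.** Let $N$ be a finite set of players with a fixed linear order. A network is a set $g$ of links (unordered pairs $ij$, $i\ne j$) of players; $N(g)$ is the set of players that have a link in $g$, $g_i$ the set of links of $i$ in $g$, and $C(g)$ the set of components of $g$ (maximal connected non-empty subnetworks). A value function is a real function $v$ on networks with $v(\emptyset)=0$; it is component additive if $v(g)=\sum_{h\in C(g)}v(h)$ for every network $g$. It is zero-monotonic on $g$ if $v(g')-v(g'_i)\ge v(g'\setminus g'_i)$ for all $g'\subseteq g$ and $i\in N(g')$. For weights $w_i>0$ $(i\in N)$ the weighted Myerson value is $$Y_i^{w}(g,v)=\sum_{g'\subseteq g,\ i\in N(g')}\frac{w_i}{\sum_{j\in N(g')}w_j}\,\lambda_{g'}(v),\qquad \lambda_{g'}(v)=\sum_{g''\subseteq g'}(-1)^{|g'|-|g''|}v(g'').$$ **The mechanism $\Gamma^{w\text{-}MV}(g,v)$** is defined by recursion on the number of links. Players without links receive $0$. The components of $g$ play separately and in parallel; on a component $h$ one round consists of three stages, where all earlier actions in the same component are observed. 1. All players $i\in N(h)$ simultaneously make bids $b^i_j\in\mathbb R$ to all $j\in N(h)\setminus i$. The weighted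 net bid of $i$ is $B^i=\sum_{j\ne i}w_ib^i_j-\sum_{j\ne i}w_jb^j_i$. The proposer $i^*$ is drawn uniformly at random from the players with the highest net bid, and pays $b^{i^*}_j$ to each $j\in N(h)\setminus i^*$. 2. The proposer offers payoffs $y_j\in\mathbb R$ to all $j\in N(h)\setminus i^*$. 3. The players in $N(h)\setminus i^*$ accept or reject, one after the other in the given order. If all accept, each $j\neq i^*$ receives $y_j$, $i^*$ receives $v(h)-\sum_{j\ne i^*}y_j$, and play on $h$ ends. If at least one rejects, the mechanism $\Gamma^{w\text{-}MV}(h\setminus h_{i^*},v)$ is played next (so $i^*$ receives $0$ from it). The final payoff of a player is the sum of all bids received minus all bids paid, plus the payoff with which her play ends; players maximize expected payoff. **Theorem.** Let $w_i>0$ for all $i\in N$, let $g$ be any network on $N$, and let $v$ be a component additive value function that is zero-monotonic on $g$ and satisfies $v(\{ij\})\ge 0$ for every link $ij\in g$. Then $\Gamma^{w\text{-}MV}(g,v)$ has a subgame perfect Nash equilibrium (in pure strategies) in which the expected payoff of every player $i$ is $Y^{w}_i(g,v)$; moreover, whichever top bidders are drawn as proposers when this equilibrium is played, the realized payoff of every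 player $i$ is $Y^{w}_i(g,v)$. -/

import Mathlib

/-! ## Networks, value functions, weighted Myerson value

A network on the finite player set `N` is a `SimpleGraph N`: its links are the edges,
`g' ≤ g` is inclusion of link sets and `⊥` is the empty network. -/

namespace NetworkGame

open Classical in
/-- The set `N(g)` of players that have at least one link in `g`. -/
noncomputable def players {N : Type} [Fintype N] (g : SimpleGraph N) : Finset N :=
  Finset.univ.filter fun i => ∃ j, g.Adj i j

theorem mem_players {N : Type} [Fintype N] {g : SimpleGraph N} {i : N} :
    i ∈ players g ↔ ∃ j, g.Adj i j := by
  simp [players]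

/-- The network consisting of the links of player `i` in `g`. -/
def linksOf {N : Type} (g : SimpleGraph N) (i : N) : SimpleGraph N where
  Adj a b := g.Adj a b ∧ (a = i ∨ b = i)
  symm := ⟨fun _ _ h => ⟨h.1.symm, h.2.symm⟩⟩
  loopless := ⟨fun a h => g.loopless.irrefl a h.1⟩

/-- The network `g` without the links of player `i`. -/
def deleteLinksOf {N : Type} (g : SimpleGraph N) (i : N) : SimpleGraph N :=
  g \ linksOf g i

/-- The network whose only link is `ij` (for `i ≠ j`). -/
def singleLink {N : Type} (i j : N) : SimpleGraph N :=
  SimpleGraph.fromEdgeSet {s(i, j)}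

/-- `h` is a component of `g`: a non-empty subnetwork, any two of its players are connected
by a path in `h`, and it contains every link of `g` at each of its players. -/
def IsComponent {N : Type} [Fintype N] (g h : SimpleGraph N) : Prop :=
  h ≠ ⊥ ∧ h ≤ g ∧ (∀ i ∈ players h, ∀ j ∈ players h, h.Reachable i j) ∧
    ∀ i ∈ players h, ∀ j, g.Adj i j → h.Adj i j

/-- A value function: a real function on networks that vanishes at the empty network. -/
def IsValueFunction {N : Type} (v : SimpleGraph N → ℝ) : Prop := v ⊥ = 0

open Classical in
/-- The value of each network is the sum of the values of its components. -/
def IsComponentAdditive {N : Type} [Fintype N] (v : SimpleGraph N → ℝ) : Prop :=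
  ∀ g : SimpleGraph N, v g = ∑ h ∈ Finset.univ.filter (fun h => IsComponent g h), v h

/-- Zero-monotonicity on the subnetworks of `g`. -/
def IsZeroMonotonic {N : Type} [Fintype N] (g : SimpleGraph N) (v : SimpleGraph N → ℝ) : Prop :=
  ∀ g' ≤ g, ∀ i ∈ players g', v (deleteLinksOf g' i) ≤ v g' - v (linksOf g' i)

open Classical in
/-- The Harsanyi dividend (unanimity coefficient) `λ_g(v)`. -/
noncomputable def dividend {N : Type} [Fintype N] (v : SimpleGraph N → ℝ)
    (g : SimpleGraph N) : ℝ :=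
  ∑ g' ∈ Finset.univ.filter (fun g' => g' ≤ g),
    (-1) ^ (g.edgeSet.ncard - g'.edgeSet.ncard) * v g'

open Classical in
/-- The weighted Myerson value of player `i`. -/
noncomputable def weightedMyerson {N : Type} [Fintype N] (w : N → ℝ) (g : SimpleGraph N)
    (v : SimpleGraph N → ℝ) (i : N) : ℝ :=
  ∑ g' ∈ Finset.univ.filter (fun g' => g' ≤ g ∧ i ∈ players g'),
    w i / (∑ j ∈ players g', w j) * dividend v g'

/-! ## Extensive-form games with observed actions -/

/-- Game trees with observed actions, simultaneous moves, chance moves, side payments and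
independent parallel play. -/
inductive Game (N : Type) : Type 1
  /-- The game is over and `i` receives `u i`. -/
  | terminal (u : N → ℝ) : Game N
  /-- Player `i` receives the (possibly negative) amount `t i`, then `G` is played. -/
  | transfer (t : N → ℝ) (G : Game N) : Game N
  /-- An element of `ι` is drawn uniformly at random and publicly observed. -/
  | chance (ι : Type) [Fintype ι] [Nonempty ι] (G : ι → Game N) : Game N
  /-- The players `i ∈ S` simultaneously choose actions in `A i`, which are then observed. -/
  | move (S : Finset N) (A : N → Type) (G : ((i : N) → i ∈ S → A i) → Game N) : Game N
  /-- The games `G k` are played separately, and the payoffs are added. -/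
  | parallel (ι : Type) [Fintype ι] (G : ι → Game N) : Game N

namespace Game

/-- Pure strategies of player `i`: an action at every node of the tree where `i` moves. -/
def Strategy {N : Type} (i : N) : Game N → Type
  | terminal _ => Unit
  | transfer _ G => Strategy i G
  | chance ι G => (k : ι) → Strategy i (G k)
  | move S A G => (i ∈ S → A i) × ((a : (j : N) → j ∈ S → A j) → Strategy i (G a))
  | parallel ι G => (k : ι) → Strategy i (G k)

/-- Strategy profiles. -/
abbrev Profile {N : Type} (G : Game N) : Type := (i : N) → Strategy i G

/-- Expected payoffs when the profile `σ` is played. -/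
noncomputable def payoff {N : Type} : (G : Game N) → Profile G → N → ℝ
  | terminal u, _ => u
  | transfer t G, σ => fun i => t i + payoff G σ i
  | chance ι G, σ => fun i => (∑ k : ι, payoff (G k) (fun j => σ j k) i) / Fintype.card ι
  | move _ _ G, σ =>
      payoff (G fun j hj => (σ j).1 hj) (fun j => (σ j).2 fun l hl => (σ l).1 hl)
  | parallel ι G, σ => fun i => ∑ k : ι, payoff (G k) (fun j => σ j k) i

/-- `Realizes G σ u`: when `σ` is played, `u` is the payoff vector for some realization of
the chance moves (each of which has positive probability). -/
def Realizes {N : Type} : (G : Game N) → Profile G → (N → ℝ) → Prop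
  | terminal u', _, u => u = u'
  | transfer t G, σ, u => ∃ u', Realizes G σ u' ∧ u = t + u'
  | chance _ G, σ, u => ∃ k, Realizes (G k) (fun j => σ j k) u
  | move _ _ G, σ, u =>
      Realizes (G fun j hj => (σ j).1 hj) (fun j => (σ j).2 fun l hl => (σ l).1 hl) u
  | parallel ι G, σ, u =>
      ∃ u' : ι → N → ℝ, (∀ k, Realizes (G k) (fun j => σ j k) (u' k)) ∧ u = ∑ k, u' k

/-- Nash equilibrium: no player has a profitable deviation to another strategy. -/
def IsNash {N : Type} [DecidableEq N] (G : Game N) (σ : Profile G) : Prop :=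
  ∀ (i : N) (τ : Strategy i G), payoff G (Function.update σ i τ) i ≤ payoff G σ i

/-- Subgame perfect Nash equilibrium: `σ` induces a Nash equilibrium in every subgame. -/
def IsSubgamePerfect {N : Type} [DecidableEq N] : (G : Game N) → Profile G → Prop
  | terminal u, σ => IsNash (terminal u) σ
  | transfer t G, σ => IsNash (transfer t G) σ ∧ IsSubgamePerfect G σ
  | chance ι G, σ => IsNash (chance ι G) σ ∧ ∀ k, IsSubgamePerfect (G k) fun j => σ j k
  | move S A G, σ => IsNash (move S A G) σ ∧ ∀ a, IsSubgamePerfect (G a) fun j => (σ j).2 a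
  | parallel ι G, σ => IsNash (parallel ι G) σ ∧ ∀ k, IsSubgamePerfect (G k) fun j => σ j k

end Game

/-! ## The weighted bidding mechanism -/

/-- The other players of the network `h`. -/
noncomputable def others {N : Type} [Fintype N] [DecidableEq N] (h : SimpleGraph N) (i : N) :
    Finset N := (players h).erase i

/-- Real numbers addressed to the other players of `h`: the bids of `i`, or an offer of `i`. -/
abbrev ToOthers {N : Type} [Fintype N] [DecidableEq N] (h : SimpleGraph N) (i : N) : Type :=
  {j // j ∈ others h i} → ℝ

theorem mem_players_of_mem_others {N : Type} [Fintype N] [DecidableEq N] {h : SimpleGraph N}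
    {i j : N} (hj : j ∈ others h i) : j ∈ players h := Finset.mem_of_mem_erase hj

theorem mem_others_symm {N : Type} [Fintype N] [DecidableEq N] {h : SimpleGraph N}
    {i j : N} (hi : i ∈ players h) (hj : j ∈ others h i) : i ∈ others h j :=
  Finset.mem_erase.2 ⟨(Finset.ne_of_mem_erase hj).symm, hi⟩

/-- Player `p` has the amount `c` and gives `x j` to every other player `j` of `h`. -/
noncomputable def settle {N : Type} [Fintype N] [DecidableEq N] (h : SimpleGraph N) (p : N)
    (c : ℝ) (x : ToOthers h p) : N → ℝ :=
  fun j => if hj : j ∈ others h p then x ⟨j, hj⟩ else if j = p then c - ∑ l, x l else 0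

/-- The weighted net bid `B^i = ∑_{j ≠ i} w_i b^i_j - ∑_{j ≠ i} w_j b^j_i`. -/
noncomputable def netBid {N : Type} [Fintype N] [DecidableEq N] (w : N → ℝ) (h : SimpleGraph N)
    (b : (i : N) → i ∈ players h → ToOthers h i) (i : {i // i ∈ players h}) : ℝ :=
  ∑ j : {j // j ∈ others h i.1}, w i.1 * b i.1 i.2 j -
    ∑ j : {j // j ∈ others h i.1},
      w j.1 * b j.1 (mem_players_of_mem_others j.2) ⟨i.1, mem_others_symm i.2 j.2⟩

/-- The players with maximal weighted net bid. -/
abbrev TopBidder {N : Type} [Fintype N] [DecidableEq N] (w : N → ℝ) (h : SimpleGraph N)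
    (b : (i : N) → i ∈ players h → ToOthers h i) : Type :=
  {p : {i // i ∈ players h} // ∀ q, netBid w h b q ≤ netBid w h b p}

noncomputable instance {N : Type} [Fintype N] [DecidableEq N] (w : N → ℝ) (h : SimpleGraph N)
    (b : (i : N) → i ∈ players h → ToOthers h i) : Fintype (TopBidder w h b) :=
  Fintype.ofFinite _

theorem TopBidder.nonempty {N : Type} [Fintype N] [DecidableEq N] (w : N → ℝ)
    (h : SimpleGraph N) (b : (i : N) → i ∈ players h → ToOthers h i)
    (hne : (players h).Nonempty) : Nonempty (TopBidder w h b) := by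
  have : Nonempty {i // i ∈ players h} := hne.to_subtype
  obtain ⟨p, hp⟩ := Finite.exists_max (netBid w h b)
  exact ⟨⟨p, hp⟩⟩

/-- The players in the list answer one after the other (`true` is acceptance), observing the
earlier answers. `accepted` records whether nobody has rejected so far; play continues with
`A` if everybody accepts and with `R` otherwise. -/
def responses {N : Type} (A R : Game N) : List N → Bool → Game N
  | [], accepted => if accepted then A else R
  | j :: l, accepted =>
      .move {j} (fun _ => Bool) fun a =>
        responses A R l (accepted && a j (Finset.mem_singleton_self j))

/-- Stages 2 and 3 with proposer `p`: `p` makes an offer, the other players answer in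
increasing order, and play continues with `R` if the offer is rejected. -/
noncomputable def proposal {N : Type} [Fintype N] [LinearOrder N] (v : SimpleGraph N → ℝ)
    (h : SimpleGraph N) (p : N) (R : Game N) : Game N :=
  .move {p} (fun i => ToOthers h i) fun y =>
    responses (.terminal (settle h p (v h) (y p (Finset.mem_singleton_self p)))) R
      ((others h p).sort (· ≤ ·)) true

/-- One round on a connected network `h`: all players of `h` bid, a top bidder is drawn and
pays her bids, and then makes a proposal; `next p` is played if the offer of `p` is rejected. -/
noncomputable def biddingRound {N : Type} [Fintype N] [LinearOrder N] (w : N → ℝ)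
    (v : SimpleGraph N → ℝ) (h : SimpleGraph N) (hne : (players h).Nonempty)
    (next : {i // i ∈ players h} → Game N) : Game N :=
  .move (players h) (fun i => ToOthers h i) fun b =>
    have := TopBidder.nonempty w h b hne
    .chance (TopBidder w h b) fun p =>
      .transfer (settle h p.1.1 0 (b p.1.1 p.1.2)) (proposal v h p.1.1 (next p.1))

theorem IsComponent.players_nonempty {N : Type} [Fintype N] {g h : SimpleGraph N}
    (hh : IsComponent g h) : (players h).Nonempty := by
  obtain ⟨a, b, hab⟩ := SimpleGraph.ne_bot_iff_exists_adj.1 hh.1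
  exact ⟨a, mem_players.2 ⟨b, hab⟩⟩

theorem deleteLinksOf_lt {N : Type} [Fintype N] {h : SimpleGraph N} {i : N}
    (hi : i ∈ players h) : deleteLinksOf h i < h := by
  refine lt_of_le_of_ne sdiff_le fun heq => ?_
  obtain ⟨j, hj⟩ := mem_players.1 hi
  have h1 : (deleteLinksOf h i).Adj i j := by rw [heq]; exact hj
  rw [deleteLinksOf, SimpleGraph.sdiff_adj] at h1
  exact h1.2 ⟨hj, Or.inl rfl⟩

noncomputable instance {N : Type} [Fintype N] (g : SimpleGraph N) :
    Fintype {h // IsComponent g h} := Fintype.ofFinite _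

/-- The weighted bidding mechanism `Γ^{w-MV}(g, v)`: the components of `g` play separately.
If an offer of `p` is rejected in component `h`, the mechanism is played on `h` without the
links of `p`. Players without links receive `0`. -/
noncomputable def mechanism {N : Type} [Fintype N] [LinearOrder N] (w : N → ℝ)
    (v : SimpleGraph N → ℝ) (g : SimpleGraph N) : Game N :=
  .parallel {h // IsComponent g h} fun h =>
    biddingRound w v h.1 h.2.players_nonempty fun p => mechanism w v (deleteLinksOf h.1 p.1)
termination_by wellFounded_lt.wrap g
decreasing_by exact lt_of_lt_of_le (deleteLinksOf_lt p.2) h.2.2.1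

end NetworkGame

/-! The proof is backward induction on the network. Suppose that on a component `h`, once the offer
of `p` is rejected, play continues with payoffs z_p = Y^w(h∖h_p); in particular z_p(p) = 0. It is
optimal to accept exactly the offers worth at least z_p, so `p` offers z_p and keeps v(h) -
v(h∖h_p). This is non-negative by zero-monotonicity, because the star h_p has non-negative value
(`IsZeroMonotonic.nonneg_of_star`); hence `p` does not want a rejection (`hasEquilibrium_proposal`).

Put y = Y^w(h) and let each `p` bid y_j - z_p(j) to `j`. Bid and offer together give `j` exactly
y_j, and by efficiency (`sum_weightedMyerson`) `p` is left with y_p, whoever is drawn. Weighted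
balanced contributions (`weightedMyerson_balanced`) make all these net bids zero. A deviator who is
not drawn still receives her share of y. One who is drawn has a non-negative net bid, since net bids
sum to zero; so she has not lowered her total bid and gains nothing (`hasEquilibrium_biddingRound`).

Component additivity kills the dividends of networks that split into player-disjoint parts
(`dividend_sup_eq_zero`), so the values of the components add up to the value of the whole network.
-/

namespace NetworkGame

/-! ### Assembling subgame perfect equilibria node by node -/

namespace Game

/-- `G` has a subgame perfect equilibrium with expected payoffs `u` whose realized payoffs are
all equal to `u` whenever `P` holds. -/
def HasEquilibrium {N : Type} [DecidableEq N] (G : Game N) (u : N → ℝ) (P : Prop) : Prop :=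
  ∃ σ : Profile G, IsSubgamePerfect G σ ∧ payoff G σ = u ∧ (P → ∀ u', Realizes G σ u' → u' = u)

theorem IsSubgamePerfect.isNash {N : Type} [DecidableEq N] :
    ∀ {G : Game N} {σ : Profile G}, IsSubgamePerfect G σ → IsNash G σ
  | terminal _, _, h => h
  | transfer _ _, _, h => h.1
  | chance _ _, _, h => h.1
  | move _ _ _, _, h => h.1
  | parallel _ _, _, h => h.1

theorem hasEquilibrium_terminal {N : Type} [DecidableEq N] (u : N → ℝ) (P : Prop) :
    HasEquilibrium (terminal u) u P :=
  ⟨fun _ => (), fun _ _ => le_rfl, rfl, fun _ _ h => h⟩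

theorem HasEquilibrium.transfer {N : Type} [DecidableEq N] {G : Game N} {u : N → ℝ} {P : Prop}
    (t : N → ℝ) (h : HasEquilibrium G u P) : HasEquilibrium (transfer t G) (t + u) P := by
  obtain ⟨σ, hσ, rfl, hP⟩ := h
  refine ⟨σ, ⟨fun i τ => ?_, hσ⟩, rfl, ?_⟩
  · exact add_le_add_right (hσ.isNash i τ) (t i)
  · rintro p u' ⟨u'', h, rfl⟩
    rw [hP p u'' h]

theorem update_apply_branch {N ι : Type} [DecidableEq N] {B : N → ι → Type}
    (σ : (j : N) → (k : ι) → B j k) (i : N) (τ : (k : ι) → B i k) (k : ι) :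
    (fun j => Function.update σ i τ j k) = Function.update (fun j => σ j k) i (τ k) :=
  funext fun j => Function.apply_update (fun j (x : (k : ι) → B j k) => x k) σ i τ j

/-- Branches may pay differently when `P` fails: after off-path bids the payoffs depend on who is
drawn, and only the expected payoff is controlled. -/
theorem hasEquilibrium_chance {N : Type} [DecidableEq N] {ι : Type} [Fintype ι] [Nonempty ι]
    {G : ι → Game N} {u : ι → N → ℝ} {P : Prop} (h : ∀ k, HasEquilibrium (G k) (u k) P)
    (hP : P → ∀ k l, u k = u l) :
    HasEquilibrium (chance ι G) (fun i => (∑ k, u k i) / Fintype.card ι) P := by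
  choose σ hσ hu hR using h
  refine ⟨fun j k => σ k j, ⟨fun i τ => ?_, hσ⟩, ?_, ?_⟩
  · refine div_le_div_of_nonneg_right (Finset.sum_le_sum fun k _ => ?_) (Nat.cast_nonneg _)
    have := (hσ k).isNash i (τ k)
    rwa [← update_apply_branch (B := fun j k => Strategy j (G k)) (fun j k => σ k j) i τ k]
      at this
  · funext i
    simp only [payoff, hu]
  · rintro p u' ⟨k, hk⟩
    rw [hR k p u' hk]
    funext i
    have hc : (Fintype.card ι : ℝ) ≠ 0 := by simp
    rw [Finset.sum_congr rfl fun l _ => congrFun (hP p l k) i]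
    simp [hc]

theorem hasEquilibrium_parallel {N : Type} [DecidableEq N] {ι : Type} [Fintype ι]
    {G : ι → Game N} {u : ι → N → ℝ} {P : Prop} (h : ∀ k, HasEquilibrium (G k) (u k) P) :
    HasEquilibrium (parallel ι G) (∑ k, u k) P := by
  choose σ hσ hu hR using h
  refine ⟨fun j k => σ k j, ⟨fun i τ => ?_, hσ⟩, ?_, ?_⟩
  · refine Finset.sum_le_sum fun k _ => ?_
    have := (hσ k).isNash i (τ k)
    rwa [← update_apply_branch (B := fun j k => Strategy j (G k)) (fun j k => σ k j) i τ k]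
      at this
  · funext i
    simp only [payoff, hu, Finset.sum_apply]
  · rintro p u' ⟨x, hx, rfl⟩
    exact Finset.sum_congr rfl fun k _ => hR k p _ (hx k)

/-- One-shot deviation principle at a simultaneous move. -/
theorem hasEquilibrium_move {N : Type} [DecidableEq N] {S : Finset N} {A : N → Type}
    {G : ((i : N) → i ∈ S → A i) → Game N} {u : ((i : N) → i ∈ S → A i) → N → ℝ}
    {P : ((i : N) → i ∈ S → A i) → Prop} (h : ∀ a, HasEquilibrium (G a) (u a) (P a))
    (s : (i : N) → i ∈ S → A i)
    (hs : ∀ i ∈ S, ∀ x : i ∈ S → A i, u (Function.update s i x) i ≤ u s i) :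
    HasEquilibrium (move S A G) (u s) (P s) := by
  choose σ hσ hu hR using h
  refine ⟨fun j => (s j, fun a => σ a j), ⟨fun i τ => ?_, hσ⟩, hu s, hR s⟩
  set ρ : Profile (move S A G) :=
    -- A deviation splits into a new action now and a unilateral deviation in the subgame reached by
    -- it.
    Function.update (fun j => (s j, fun a => σ a j)) i τ with hρ
  have h1 : (fun j hj => (ρ j).1 hj : (j : N) → j ∈ S → A j) = Function.update s i τ.1 :=
    funext fun j => Function.apply_update (α := fun j => Strategy j (move S A G))
      (β := fun j => j ∈ S → A j) (fun _ x => x.1) _ i τ j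
  have h2 : ∀ a, (fun j => (ρ j).2 a) = Function.update (σ a) i (τ.2 a) := fun a =>
    funext fun j => Function.apply_update (α := fun j => Strategy j (move S A G))
      (β := fun j => Strategy j (G a)) (fun _ x => x.2 a) _ i τ j
  have h3 : payoff (move S A G) ρ i
      = payoff (G (Function.update s i τ.1))
          (Function.update (σ _) i (τ.2 (Function.update s i τ.1))) i := by
    rw [← h2, ← h1]
    rfl
  rw [h3]
  -- Subgame perfection makes the later part of the deviation unprofitable, which leaves only the
  -- change of action.
  refine ((hσ _).isNash i _).trans ?_
  change _ ≤ payoff (G s) (σ s) i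
  rw [hu, hu]
  by_cases hi : i ∈ S
  · exact hs i hi _
  · have : Function.update s i τ.1 = s := by
      rw [Function.update_eq_self_iff]
      funext hi'
      exact absurd hi' hi
    rw [this]

end Game

/-! ### Answers and offers -/

open Game

-- Each player accepts iff she weakly prefers `a` to `r`, whatever happened before. Her answer
-- matters only if nobody else rejects, and then she decides between the two. Accepting in case of a
-- tie lets the proposer offer exactly the continuation payoffs.
open Classical in
theorem hasEquilibrium_responses {N : Type} [DecidableEq N] {A R : Game N} {a r : N → ℝ}
    (hA : HasEquilibrium A a True) (hR : HasEquilibrium R r True) :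
    ∀ (l : List N) (accepted : Bool), HasEquilibrium (responses A R l accepted)
      (if accepted = true ∧ ∀ j ∈ l, r j ≤ a j then a else r) True
  | [], true => by simpa [responses] using hA
  | [], false => by simpa [responses] using hR
  | j :: l, accepted => by
    have ih := hasEquilibrium_responses hA hR l
    have := hasEquilibrium_move (S := {j}) (A := fun _ => Bool)
      (P := fun _ => True)
      (fun x => ih (accepted && x j (Finset.mem_singleton_self j)))
      (fun i _ => decide (r i ≤ a i)) (by
        intro i hi x
        obtain rfl := Finset.mem_singleton.1 hi
        by_cases h1 : accepted = true ∧ ∀ k ∈ l, r k ≤ a k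
        · cases hx : x hi <;> by_cases h2 : r i ≤ a i <;> simp [h1, hx, h2]
          all_goals rw [if_pos h1.2]; linarith
        · have h3 : ∀ b : Bool, ¬ ((accepted && b) = true ∧ ∀ k ∈ l, r k ≤ a k) := by
            intro b hb
            simp only [Bool.and_eq_true] at hb
            exact h1 ⟨hb.1.1, hb.2⟩
          rw [if_neg (h3 _), if_neg (h3 _)])
    rw [responses]
    convert this using 2
    simp only [Bool.and_eq_true, decide_eq_true_eq, List.forall_mem_cons, and_assoc]

section Settle

variable {N : Type} [Fintype N] [DecidableEq N] {h : SimpleGraph N} {p : N}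

theorem settle_of_mem {c : ℝ} {x : ToOthers h p} {j : N} (hj : j ∈ others h p) :
    settle h p c x j = x ⟨j, hj⟩ := by
  simp [settle, hj]

theorem settle_self {c : ℝ} {x : ToOthers h p} : settle h p c x p = c - ∑ l, x l := by
  simp [settle, others]

theorem settle_of_notMem (hp : p ∈ players h) {c : ℝ} {x : ToOthers h p} {j : N}
    (hj : j ∉ players h) : settle h p c x j = 0 := by
  have h1 : j ∉ others h p := fun h => hj (mem_players_of_mem_others h)
  have h2 : j ≠ p := by rintro rfl; exact hj hp
  simp [settle, h1, h2]

end Settle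

theorem hasEquilibrium_proposal {N : Type} [Fintype N] [LinearOrder N] {v : SimpleGraph N → ℝ}
    {h : SimpleGraph N} {p : N} {R : Game N} {r : N → ℝ} (hR : HasEquilibrium R r True)
    (hp : r p = 0) (hv : ∑ j ∈ others h p, r j ≤ v h) :
    HasEquilibrium (proposal v h p R) (settle h p (v h) fun j => r j) True := by
  classical
  have := hasEquilibrium_move (S := {p}) (A := fun i => ToOthers h i) (P := fun _ => True)
    (fun y => hasEquilibrium_responses
      (hasEquilibrium_terminal
        (settle h p (v h) (y p (Finset.mem_singleton_self p))) True) hR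
      ((others h p).sort (· ≤ ·)) true)
    (fun i _ j => r j) (by
      intro i hi x
      obtain rfl := Finset.mem_singleton.1 hi
      have hsum : ∑ l : {j // j ∈ others h i}, r l = ∑ j ∈ others h i, r j :=
        Finset.sum_coe_sort _ _
      rw [if_pos (c := _ ∧ ∀ j ∈ _, r j ≤ settle h i (v h) (fun j => r j) j)
        ⟨rfl, fun j hj => by rw [settle_of_mem ((Finset.mem_sort _).1 hj)]⟩,
        settle_self, hsum]
      -- A deviating offer that is accepted gives every responder at least `r`, so it costs no less;
      -- one that is rejected leaves the proposer `r i = 0`.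
      split_ifs with hx
      · rw [Function.update_self, settle_self]
        refine sub_le_sub_left ?_ _
        rw [← hsum]
        refine Finset.sum_le_sum fun l _ => ?_
        have := hx.2 l.1 ((Finset.mem_sort _).2 l.2)
        rwa [Function.update_self, settle_of_mem l.2] at this
      · linarith)
  rw [if_pos ⟨rfl, fun j hj => by rw [settle_of_mem ((Finset.mem_sort _).1 hj)]⟩] at this
  exact this

/-! ### Net bids and the bidding stage -/

section Bids

variable {N : Type} [Fintype N] [DecidableEq N] {w : N → ℝ} {h : SimpleGraph N}

/-- The bid of `i` to `j`, extended by zero to all pairs of players. -/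
noncomputable def extendBid (b : (i : N) → i ∈ players h → ToOthers h i) (i j : N) : ℝ :=
  if hij : ∃ _ : i ∈ players h, j ∈ others h i then b i hij.1 ⟨j, hij.2⟩ else 0

theorem extendBid_of_mem {b : (i : N) → i ∈ players h → ToOthers h i} {i j : N}
    (hi : i ∈ players h) (hj : j ∈ others h i) : extendBid b i j = b i hi ⟨j, hj⟩ :=
  dif_pos ⟨hi, hj⟩

theorem netBid_eq (b : (i : N) → i ∈ players h → ToOthers h i) (i : {i // i ∈ players h}) :
    netBid w h b i
      = ∑ j ∈ players h, (w i.1 * extendBid b i.1 j - w j * extendBid b j i.1) := by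
  -- The diagonal term cancels, so including `i` itself is harmless and turns the total of all net
  -- bids into an antisymmetric double sum.
  rw [← Finset.sum_erase (players h) (a := i.1) (by simp), Finset.sum_sub_distrib,
    ← Finset.sum_coe_sort, ← Finset.sum_coe_sort (Finset.erase _ _), netBid]
  congr 1
  · refine Finset.sum_congr rfl fun j _ => ?_
    rw [extendBid_of_mem i.2 j.2]
  · refine Finset.sum_congr rfl fun j _ => ?_
    rw [extendBid_of_mem (mem_players_of_mem_others j.2) (mem_others_symm i.2 j.2)]

theorem sum_netBid (b : (i : N) → i ∈ players h → ToOthers h i) :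
    ∑ i, netBid w h b i = 0 := by
  simp only [netBid_eq]
  rw [Finset.sum_coe_sort (players h) fun i =>
    ∑ j ∈ players h, (w i * extendBid b i j - w j * extendBid b j i)]
  simp only [Finset.sum_sub_distrib]
  rw [Finset.sum_comm, sub_self]

theorem TopBidder.netBid_nonneg {b : (i : N) → i ∈ players h → ToOthers h i}
    (p : TopBidder w h b) : 0 ≤ netBid w h b p.1 := by
  by_contra! hp
  have : ∑ i, netBid w h b i < 0 :=
    Finset.sum_neg (fun q _ => (p.2 q).trans_lt hp) ⟨p.1, Finset.mem_univ _⟩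
  exact this.ne (sum_netBid b)

end Bids

/-- A bidding round whose continuation payoffs satisfy weighted balanced contributions. -/
theorem hasEquilibrium_biddingRound {N : Type} [Fintype N] [LinearOrder N] {w : N → ℝ}
    (hw : ∀ i, 0 < w i) {v : SimpleGraph N → ℝ} {h : SimpleGraph N}
    (hne : (players h).Nonempty) {next : {i // i ∈ players h} → Game N}
    {y : N → ℝ} {z : {i // i ∈ players h} → N → ℝ}
    (hnext : ∀ p, HasEquilibrium (next p) (z p) True) (hz : ∀ p, z p p.1 = 0)
    (hle : ∀ p : {i // i ∈ players h}, ∑ j ∈ others h p.1, z p j ≤ v h)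
    (hbal : ∀ p q : {i // i ∈ players h}, w p.1 * (y q.1 - z p q.1) = w q.1 * (y p.1 - z q p.1))
    (hy : ∑ j ∈ players h, y j = v h) (hy0 : ∀ j ∉ players h, y j = 0) :
    HasEquilibrium (biddingRound w v h hne next) y True := by
  classical
  -- The bid to `j` tops up her continuation payoff, which is what she will be offered, to `y j`.
  set s : (i : N) → i ∈ players h → ToOthers h i := fun i hi j => y j - z ⟨i, hi⟩ j with hs
  set U : ((i : N) → i ∈ players h → ToOthers h i) → {i // i ∈ players h} → N → ℝ :=
    fun b p => settle h p.1 0 (b p.1 p.2) + settle h p.1 (v h) (fun j => z p j) with hU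
  -- A proposer loses exactly the excess of her total bid over the one prescribed by `s`.
  have hUself : ∀ b p, U b p p.1 = y p.1 - ∑ j, (b p.1 p.2 j - s p.1 p.2 j) := by
    intro b p
    have h1 : ∑ j : {j // j ∈ others h p.1}, y j.1 = v h - y p.1 := by
      rw [Finset.sum_coe_sort (others h p.1) y, others, ← hy, ← Finset.sum_erase_add _ y p.2]
      ring
    simp only [hU, Pi.add_apply, settle_self, hs, Finset.sum_sub_distrib, h1]
    ring
  have hUs : ∀ b p, b p.1 p.2 = s p.1 p.2 → U b p = y := by
    intro b p hb
    funext i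
    by_cases hi : i ∈ players h
    · by_cases hip : i = p.1
      · subst hip
        rw [hUself, hb]
        simp
      · have : i ∈ others h p.1 := Finset.mem_erase.2 ⟨hip, hi⟩
        simp only [hU, Pi.add_apply, settle_of_mem this, hb, hs]
        ring
    · simp only [hU, Pi.add_apply, settle_of_notMem p.2 hi, hy0 i hi, add_zero]
  -- Realized payoffs are independent of the draw only after the equilibrium bids, hence this choice
  -- of `P`.
  have key := hasEquilibrium_move (P := fun b => b = s)
    (G := fun b =>
      have := TopBidder.nonempty w h b hne
      .chance (TopBidder w h b) fun p =>
        .transfer (settle h p.1.1 0 (b p.1.1 p.1.2)) (proposal v h p.1.1 (next p.1)))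
    (u := fun b i => (∑ p : TopBidder w h b, U b p.1 i) / Fintype.card (TopBidder w h b))
    (fun b => by
      have := TopBidder.nonempty w h b hne
      refine hasEquilibrium_chance (u := fun p : TopBidder w h b => U b p.1) (fun p => ?_) ?_
      · obtain ⟨σ, h1, h2, h3⟩ :=
          (hasEquilibrium_proposal (v := v) (hnext p.1) (hz p.1) (hle p.1)).transfer
            (settle h p.1.1 0 (b p.1.1 p.1.2))
        exact ⟨σ, h1, h2, fun _ => h3 trivial⟩
      · rintro rfl k l
        rw [hUs _ _ rfl, hUs _ _ rfl])
    s
  have hval : (fun i => (∑ p : TopBidder w h s, U s p.1 i) / Fintype.card (TopBidder w h s))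
      = y := by
    have := TopBidder.nonempty w h s hne
    funext i
    have hc : (Fintype.card (TopBidder w h s) : ℝ) ≠ 0 := by simp
    simp only [hUs s _ rfl]
    simp [hc]
  obtain ⟨σ, h1, h2, h3⟩ := key fun i hi x => by
    have := TopBidder.nonempty w h (Function.update s i x) hne
    have hc : (0 : ℝ) < Fintype.card (TopBidder w h (Function.update s i x)) := by
      exact_mod_cast Fintype.card_pos
    have hval' := congrFun hval i
    rw [hval', div_le_iff₀ hc]
    suffices ∀ p : TopBidder w h (Function.update s i x),
        U (Function.update s i x) p.1 i ≤ y i by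
      refine (Finset.sum_le_card_nsmul _ _ _ fun p _ => this p).trans_eq ?_
      rw [Finset.card_univ, nsmul_eq_mul, mul_comm]
    intro p
    by_cases hip : p.1.1 = i
    · obtain ⟨⟨q, hq⟩, hp⟩ := p
      dsimp only at hip
      subst hip
      have h0 := TopBidder.netBid_nonneg ⟨⟨q, hq⟩, hp⟩
      -- By `hbal` the weighted bids received by `q` equal the weighted bids `s` prescribes for her,
      -- so her net bid measures her excess.
      have hD : netBid w h (Function.update s q x) ⟨q, hq⟩
          = w q * ∑ j, (Function.update s q x q hq j - s q hq j) := by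
        rw [netBid, ← Finset.sum_sub_distrib, Finset.mul_sum]
        refine Finset.sum_congr rfl fun j _ => ?_
        have hj : j.1 ≠ q := Finset.ne_of_mem_erase j.2
        rw [Function.update_of_ne hj]
        have := hbal ⟨q, hq⟩ ⟨j.1, mem_players_of_mem_others j.2⟩
        simp only [hs]
        simp only at this
        rw [← this]
        ring
      rw [hD] at h0
      have := nonneg_of_mul_nonneg_right h0 (hw q)
      have h4 := hUself (Function.update s q x) ⟨q, hq⟩
      simp only at h4 ⊢
      rw [h4]
      linarith
    -- If another player is drawn, her bids are those of `s`, and the deviator still receives `y i`.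
    · rw [hUs _ p.1 (by rw [Function.update_of_ne hip])]
  exact ⟨σ, h1, h2.trans hval, fun _ u' hu' => (h3 rfl u' hu').trans hval⟩

/-! ## The weighted Myerson value -/

theorem deleteLinksOf_adj {N : Type} {g : SimpleGraph N} {i a b : N} :
    (deleteLinksOf g i).Adj a b ↔ g.Adj a b ∧ a ≠ i ∧ b ≠ i := by
  simp only [deleteLinksOf, linksOf, SimpleGraph.sdiff_adj]
  tauto

/-! ### Components and player-disjoint unions -/

section Networks

variable {N : Type} [Fintype N]

theorem players_mono {g h : SimpleGraph N} (hgh : g ≤ h) : players g ⊆ players h := by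
  intro i hi
  obtain ⟨j, hj⟩ := mem_players.1 hi
  exact mem_players.2 ⟨j, hgh hj⟩

theorem eq_bot_of_le_of_le {a b h : SimpleGraph N} (hab : Disjoint (players a) (players b))
    (ha : h ≤ a) (hb : h ≤ b) : h = ⊥ := by
  by_contra hne
  obtain ⟨i, j, hij⟩ := SimpleGraph.ne_bot_iff_exists_adj.1 hne
  exact Finset.disjoint_left.1 hab (mem_players.2 ⟨j, ha hij⟩) (mem_players.2 ⟨j, hb hij⟩)

theorem mem_players_of_walk {a h : SimpleGraph N}
    (hc : ∀ i ∈ players a, ∀ j, h.Adj i j → a.Adj i j) {i j : N} (p : h.Walk i j)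
    (hi : i ∈ players a) : j ∈ players a := by
  induction p with
  | nil => exact hi
  | cons hadj _ ih => exact ih (mem_players.2 ⟨_, (hc _ hi _ hadj).symm⟩)

/-- A walk in `h` that starts at a player of `a` can never leave `a`, and connectedness lets such
walks reach every link of `h`. -/
theorem le_of_reachable {a h : SimpleGraph N}
    (hconn : ∀ i ∈ players h, ∀ j ∈ players h, h.Reachable i j)
    (hc : ∀ i ∈ players a, ∀ j, h.Adj i j → a.Adj i j) {i : N} (hih : i ∈ players h)
    (hia : i ∈ players a) : h ≤ a := by
  intro x y hxy
  obtain ⟨p⟩ := hconn i hih x (mem_players.2 ⟨y, hxy⟩)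
  exact hc x (mem_players_of_walk hc p hia) y hxy

theorem IsComponent.eq_of_mem {g h h' : SimpleGraph N} (hh : IsComponent g h)
    (hh' : IsComponent g h') {i : N} (hi : i ∈ players h) (hi' : i ∈ players h') : h = h' :=
  le_antisymm
    (le_of_reachable hh.2.2.1 (fun x hx y hxy => hh'.2.2.2 x hx y (hh.2.1 hxy)) hi hi')
    (le_of_reachable hh'.2.2.1 (fun x hx y hxy => hh.2.2.2 x hx y (hh'.2.1 hxy)) hi' hi)

theorem exists_isComponent {g : SimpleGraph N} {i : N} (hi : i ∈ players g) :
    ∃ h, IsComponent g h ∧ i ∈ players h := by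
  let h : SimpleGraph N :=
    { Adj := fun a b => g.Adj a b ∧ g.Reachable i a
      symm := ⟨fun _ _ hab => ⟨hab.1.symm, hab.2.trans hab.1.reachable⟩⟩
      loopless := ⟨fun a ha => g.loopless.irrefl a ha.1⟩ }
  -- `IsComponent` asks for paths inside `h`, so walks of `g` have to be transported.
  have hwalk : ∀ {a b : N} (p : g.Walk a b), g.Reachable i a → h.Reachable a b := by
    intro a b p
    induction p with
    | nil => exact fun _ => SimpleGraph.Reachable.refl _
    | cons hadj _ ih =>
      intro hr
      have h1 : h.Adj _ _ := ⟨hadj, hr⟩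
      exact h1.reachable.trans (ih (hr.trans hadj.reachable))
  have hreach : ∀ a ∈ players h, h.Reachable i a := by
    intro a ha
    obtain ⟨b, hb⟩ := mem_players.1 ha
    obtain ⟨p⟩ := hb.2
    exact hwalk p (SimpleGraph.Reachable.refl _)
  obtain ⟨j, hj⟩ := mem_players.1 hi
  have hij : h.Adj i j := ⟨hj, SimpleGraph.Reachable.refl _⟩
  refine ⟨h, ⟨SimpleGraph.ne_bot_iff_exists_adj.2 ⟨i, j, hij⟩, fun a b hab => hab.1,
    fun a ha b hb => (hreach a ha).symm.trans (hreach b hb), fun a ha b hab => ?_⟩,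
    mem_players.2 ⟨j, hij⟩⟩
  obtain ⟨c, hc⟩ := mem_players.1 ha
  exact ⟨hab, hc.2⟩

theorem IsComponent.sup_left {a b h : SimpleGraph N} (hab : Disjoint (players a) (players b))
    (hh : IsComponent a h) : IsComponent (a ⊔ b) h := by
  refine ⟨hh.1, hh.2.1.trans le_sup_left, hh.2.2.1, fun i hi j hij => ?_⟩
  rcases hij with hij | hij
  · exact hh.2.2.2 i hi j hij
  · exact absurd (mem_players.2 ⟨j, hij⟩)
      (Finset.disjoint_left.1 hab (players_mono hh.2.1 hi))

theorem IsComponent.of_sup_left {a b h : SimpleGraph N}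
    (hab : Disjoint (players a) (players b)) (hh : IsComponent (a ⊔ b) h) {i : N}
    (hi : i ∈ players h) (hia : i ∈ players a) : IsComponent a h := by
  refine ⟨hh.1, le_of_reachable hh.2.2.1 (fun x hx y hxy => ?_) hi hia, hh.2.2.1,
    fun x hx y hxy => hh.2.2.2 x hx y (Or.inl hxy)⟩
  rcases hh.2.1 hxy with h1 | h1
  · exact h1
  · exact absurd (mem_players.2 ⟨y, h1⟩) (Finset.disjoint_left.1 hab hx)

theorem isComponent_sup_iff {a b h : SimpleGraph N} (hab : Disjoint (players a) (players b)) :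
    IsComponent (a ⊔ b) h ↔ IsComponent a h ∨ IsComponent b h := by
  constructor
  · intro hh
    obtain ⟨i, j, hij⟩ := SimpleGraph.ne_bot_iff_exists_adj.1 hh.1
    have hi : i ∈ players h := mem_players.2 ⟨j, hij⟩
    rcases hh.2.1 hij with h1 | h1
    · exact Or.inl (hh.of_sup_left hab hi (mem_players.2 ⟨j, h1⟩))
    · rw [sup_comm] at hh
      exact Or.inr (hh.of_sup_left hab.symm hi (mem_players.2 ⟨j, h1⟩))
  · rintro (hh | hh)
    · exact hh.sup_left hab
    · rw [sup_comm]
      exact hh.sup_left hab.symm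

theorem IsComponentAdditive.sup {v : SimpleGraph N → ℝ} (hadd : IsComponentAdditive v)
    {a b : SimpleGraph N} (hab : Disjoint (players a) (players b)) :
    v (a ⊔ b) = v a + v b := by
  classical
  rw [hadd (a ⊔ b), hadd a, hadd b, ← Finset.sum_union]
  · refine Finset.sum_congr ?_ fun _ _ => rfl
    ext h
    simp [isComponent_sup_iff hab]
  · rw [Finset.disjoint_filter]
    exact fun h _ ha hb => ha.1 (eq_bot_of_le_of_le hab ha.2.1 hb.2.1)

/-! ### Dividends and Möbius inversion -/

open Classical in
theorem sum_neg_one_pow_between (x g : SimpleGraph N) (hxg : x ≤ g) :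
    ∑ y ∈ Finset.univ.filter (fun y => x ≤ y ∧ y ≤ g),
      (-1 : ℝ) ^ (y.edgeSet.ncard - x.edgeSet.ncard) = if x = g then 1 else 0 := by
  have h1 : ∑ y ∈ Finset.univ.filter (fun y => x ≤ y ∧ y ≤ g),
      (-1 : ℝ) ^ (y.edgeSet.ncard - x.edgeSet.ncard)
      = ∑ t ∈ (g.edgeSet \ x.edgeSet).toFinset.powerset, (-1 : ℝ) ^ t.card := by
    -- The interval from `x` to `g` is the Boolean lattice of sets of links in `g \ x`, where
    -- alternating sums vanish unless the lattice is trivial.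
    refine Finset.sum_bij' (fun y _ => (y.edgeSet \ x.edgeSet).toFinset)
      (fun t _ => x ⊔ SimpleGraph.fromEdgeSet (t : Set (Sym2 N))) ?_ ?_ ?_ ?_ ?_
    · intro y hy
      simp only [Finset.mem_filter, Finset.mem_univ, true_and] at hy
      rw [Finset.mem_powerset, Set.toFinset_subset_toFinset]
      exact Set.sdiff_subset_sdiff_left (SimpleGraph.edgeSet_mono hy.2)
    · intro t ht
      rw [Finset.mem_powerset, Set.subset_toFinset] at ht
      simp only [Finset.mem_filter, Finset.mem_univ, true_and]
      refine ⟨le_sup_left, sup_le hxg ?_⟩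
      intro a b hab
      rw [SimpleGraph.fromEdgeSet_adj] at hab
      exact (ht hab.1).1
    · intro y hy
      simp only [Finset.mem_filter, Finset.mem_univ, true_and] at hy
      rw [Set.coe_toFinset, ← SimpleGraph.edgeSet_sdiff, SimpleGraph.fromEdgeSet_edgeSet,
        sup_sdiff_cancel_right hy.1]
    · intro t ht
      rw [Finset.mem_powerset, Set.subset_toFinset] at ht
      ext e
      -- `SimpleGraph.fromEdgeSet` discards loops, but `t` contains none.
      have hd : e ∈ t → e ∉ {e : Sym2 N | e.IsDiag} :=
        fun he => g.not_isDiag_of_mem_edgeSet (ht he).1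
      have hx : e ∈ t → e ∉ x.edgeSet := fun he => (ht he).2
      simp only [Set.mem_toFinset, SimpleGraph.edgeSet_sup, SimpleGraph.edgeSet_fromEdgeSet,
        Set.mem_sdiff, Set.mem_union, Finset.mem_coe]
      tauto
    · intro y hy
      simp only [Finset.mem_filter, Finset.mem_univ, true_and] at hy
      rw [← Set.ncard_eq_toFinset_card', Set.ncard_sdiff (SimpleGraph.edgeSet_mono hy.1)]
  have h2 := congrArg (Int.cast : ℤ → ℝ)
    (Finset.sum_powerset_neg_one_pow_card (x := (g.edgeSet \ x.edgeSet).toFinset))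
  push_cast at h2
  rw [h1, h2]
  refine if_congr ?_ rfl rfl
  rw [Set.toFinset_eq_empty, Set.sdiff_eq_empty, SimpleGraph.edgeSet_subset_edgeSet]
  exact ⟨fun h => le_antisymm hxg h, fun h => h.ge⟩

open Classical in
/-- Möbius inversion for dividends. -/
theorem sum_dividend (v : SimpleGraph N → ℝ) (g : SimpleGraph N) :
    ∑ y ∈ Finset.univ.filter (fun y => y ≤ g), dividend v y = v g := by
  simp only [dividend]
  rw [Finset.sum_comm' (t' := Finset.univ.filter (fun x => x ≤ g))
    (s' := fun x => Finset.univ.filter (fun y => x ≤ y ∧ y ≤ g))]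
  · simp only [← Finset.sum_mul]
    rw [Finset.sum_congr rfl fun x hx => by
      rw [sum_neg_one_pow_between x g (Finset.mem_filter.1 hx).2]]
    simp
  · intro y x
    simp only [Finset.mem_filter, Finset.mem_univ, true_and]
    exact ⟨fun h => ⟨⟨h.2, h.1⟩, h.2.trans h.1⟩, fun h => ⟨h.1.2, h.1.1⟩⟩

theorem dividend_bot {v : SimpleGraph N → ℝ} (hv : IsValueFunction v) : dividend v ⊥ = 0 := by
  classical
  have h : (Finset.univ.filter fun y : SimpleGraph N => y ≤ ⊥) = {⊥} := by
    ext y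
    simp
  have := sum_dividend v ⊥
  rw [hv] at this
  convert this
  rw [h, Finset.sum_singleton]

/-- By induction, proper subnetworks meeting both parts contribute nothing to `v (a ⊔ b)`. Those
inside `a` or `b` already contribute `v a + v b`, so nothing is left for the top dividend. -/
theorem dividend_sup_eq_zero {v : SimpleGraph N → ℝ} (hv : IsValueFunction v)
    (hadd : IsComponentAdditive v) (g : SimpleGraph N) :
    ∀ a b : SimpleGraph N, a ≠ ⊥ → b ≠ ⊥ → Disjoint (players a) (players b) → a ⊔ b = g →
      dividend v g = 0 := by
  classical
  induction g using WellFoundedLT.induction with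
  | _ g ih =>
    rintro a b ha hb hab rfl
    have hterm : ∀ x ∈ Finset.univ.filter (fun x => x ≤ a ⊔ b), dividend v x
        = (if x ≤ a then dividend v x else 0) + (if x ≤ b then dividend v x else 0)
          + if x = a ⊔ b then dividend v x else 0 := by
      intro x hx
      have hx : x ≤ a ⊔ b := (Finset.mem_filter.1 hx).2
      by_cases hxa : x ≤ a
      · have h1 : x ≠ a ⊔ b := by
          rintro rfl
          exact hb (eq_bot_of_le_of_le hab (le_sup_right.trans hxa) le_rfl)
        by_cases hxb : x ≤ b
        -- Only the empty network is counted in both parts, and its dividend is zero.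
        · rw [eq_bot_of_le_of_le hab hxa hxb, dividend_bot hv]
          simp
        · simp [hxa, hxb, h1]
      · by_cases hxb : x ≤ b
        · have h1 : x ≠ a ⊔ b := by
            rintro rfl
            exact ha (eq_bot_of_le_of_le hab le_rfl (le_sup_left.trans hxb))
          simp [hxa, hxb, h1]
        · by_cases h1 : x = a ⊔ b
          · rw [if_neg hxa, if_neg hxb, if_pos h1, zero_add, zero_add]
          · have hsup : x ⊓ a ⊔ x ⊓ b = x := by rw [← inf_sup_left, inf_eq_left.2 hx]
            rw [ih x (lt_of_le_of_ne hx h1) (x ⊓ a) (x ⊓ b) ?_ ?_ ?_ hsup]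
            · simp
            · intro h0
              rw [h0, bot_sup_eq, inf_eq_left] at hsup
              exact hxb hsup
            · intro h0
              rw [h0, sup_bot_eq, inf_eq_left] at hsup
              exact hxa hsup
            · exact Finset.disjoint_of_subset_left (players_mono inf_le_right)
                (Finset.disjoint_of_subset_right (players_mono inf_le_right) hab)
    have hle : ∀ c ≤ a ⊔ b, (∑ x ∈ Finset.univ.filter (fun x => x ≤ a ⊔ b),
        if x ≤ c then dividend v x else 0) = v c := by
      intro c hc
      rw [← Finset.sum_filter, Finset.filter_filter, ← sum_dividend v c]
      refine Finset.sum_congr ?_ fun _ _ => rfl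
      ext x
      simp only [Finset.mem_filter, Finset.mem_univ, true_and]
      exact ⟨fun h => h.2, fun h => ⟨h.trans hc, h⟩⟩
    have htot := sum_dividend v (a ⊔ b)
    rw [Finset.sum_congr (by ext; simp) hterm, Finset.sum_add_distrib, Finset.sum_add_distrib,
      hle a le_sup_left, hle b le_sup_right, Finset.sum_ite_eq' , if_pos (by simp),
      hadd.sup hab] at htot
    linarith

/-! ### Efficiency, balance and locality of the weighted Myerson value -/

open Classical in
theorem weightedMyerson_eq (w : N → ℝ) (g : SimpleGraph N) (v : SimpleGraph N → ℝ) (i : N) :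
    weightedMyerson w g v i = ∑ y ∈ Finset.univ.filter (fun y => y ≤ g),
      if i ∈ players y then w i / (∑ j ∈ players y, w j) * dividend v y else 0 := by
  rw [weightedMyerson, ← Finset.sum_filter, Finset.filter_filter]

theorem weightedMyerson_of_notMem (w : N → ℝ) {g : SimpleGraph N} (v : SimpleGraph N → ℝ)
    {i : N} (hi : i ∉ players g) : weightedMyerson w g v i = 0 := by
  classical
  rw [weightedMyerson_eq]
  refine Finset.sum_eq_zero fun y hy => if_neg fun h => hi ?_
  exact players_mono (Finset.mem_filter.1 hy).2 h

theorem sum_weightedMyerson {w : N → ℝ} (hw : ∀ i, 0 < w i) {v : SimpleGraph N → ℝ}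
    (hv : IsValueFunction v) {g : SimpleGraph N} {S : Finset N} (hS : players g ⊆ S) :
    ∑ i ∈ S, weightedMyerson w g v i = v g := by
  classical
  simp only [weightedMyerson_eq]
  rw [Finset.sum_comm, ← sum_dividend v g]
  refine Finset.sum_congr (by ext; simp) fun y hy => ?_
  have hyS : players y ⊆ S := (players_mono (Finset.mem_filter.1 hy).2).trans hS
  rw [← Finset.sum_filter, Finset.filter_mem_eq_inter, Finset.inter_eq_right.2 hyS,
    ← Finset.sum_mul, ← Finset.sum_div]
  -- The shares of a dividend sum to one, except for the empty network, where the quotient is 0/0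
  -- but the dividend vanishes.
  rcases (players y).eq_empty_or_nonempty with h | h
  · have : y = ⊥ := by
      by_contra hne
      obtain ⟨i, j, hij⟩ := SimpleGraph.ne_bot_iff_exists_adj.1 hne
      have : i ∈ players y := mem_players.2 ⟨j, hij⟩
      simp [h] at this
    rw [this, dividend_bot hv, mul_zero]
  · rw [div_self (Finset.sum_pos (fun i _ => hw i) h).ne', one_mul]

theorem notMem_players_deleteLinksOf (g : SimpleGraph N) (i : N) :
    i ∉ players (deleteLinksOf g i) := by
  intro hi
  obtain ⟨j, hj⟩ := mem_players.1 hi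
  exact (deleteLinksOf_adj.1 hj).2.1 rfl

theorem le_deleteLinksOf_iff {g y : SimpleGraph N} {i : N} :
    y ≤ deleteLinksOf g i ↔ y ≤ g ∧ i ∉ players y := by
  constructor
  · exact fun h => ⟨h.trans sdiff_le,
      fun hi => notMem_players_deleteLinksOf g i (players_mono h hi)⟩
  · rintro ⟨h, hi⟩ a b hab
    refine deleteLinksOf_adj.2 ⟨h hab, ?_, ?_⟩
    · rintro rfl
      exact hi (mem_players.2 ⟨b, hab⟩)
    · rintro rfl
      exact hi (mem_players.2 ⟨a, hab.symm⟩)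

-- Deleting the links of `i` removes exactly the dividends of networks containing `i`. Apart from
-- the factor `w j`, the result is symmetric in `i` and `j`, which is the source of balanced
-- contributions.
open Classical in
theorem weightedMyerson_sub_deleteLinksOf (w : N → ℝ) (g : SimpleGraph N)
    (v : SimpleGraph N → ℝ) (i j : N) :
    weightedMyerson w g v j - weightedMyerson w (deleteLinksOf g i) v j
      = w j * ∑ y ∈ Finset.univ.filter (fun y => y ≤ g),
        if i ∈ players y ∧ j ∈ players y then dividend v y / (∑ k ∈ players y, w k) else 0 := by
  have h : Finset.univ.filter (fun y => y ≤ deleteLinksOf g i)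
      = (Finset.univ.filter (fun y => y ≤ g)).filter (fun y => i ∉ players y) := by
    ext y
    simp [le_deleteLinksOf_iff]
  rw [weightedMyerson_eq, weightedMyerson_eq, h, Finset.sum_filter (fun y => i ∉ players y),
    ← Finset.sum_sub_distrib, Finset.mul_sum]
  refine Finset.sum_congr rfl fun y _ => ?_
  by_cases hi : i ∈ players y <;> by_cases hj : j ∈ players y <;> simp [hi, hj]
  ring

open Classical in
/-- The weighted Myerson value has weighted balanced contributions. -/
theorem weightedMyerson_balanced (w : N → ℝ) (g : SimpleGraph N) (v : SimpleGraph N → ℝ)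
    (i j : N) :
    w i * (weightedMyerson w g v j - weightedMyerson w (deleteLinksOf g i) v j)
      = w j * (weightedMyerson w g v i - weightedMyerson w (deleteLinksOf g j) v i) := by
  rw [weightedMyerson_sub_deleteLinksOf, weightedMyerson_sub_deleteLinksOf,
    mul_left_comm]
  congr 2
  exact Finset.sum_congr rfl fun y _ => if_congr and_comm rfl rfl

/-- A subnetwork of `g` that contains `i` but is not inside `h` splits into player-disjoint
non-empty parts inside and outside `h`, so its dividend is zero. -/
theorem weightedMyerson_isComponent (w : N → ℝ) {v : SimpleGraph N → ℝ}
    (hv : IsValueFunction v) (hadd : IsComponentAdditive v) {g h : SimpleGraph N}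
    (hh : IsComponent g h) {i : N} (hi : i ∈ players h) :
    weightedMyerson w h v i = weightedMyerson w g v i := by
  classical
  rw [weightedMyerson_eq, weightedMyerson_eq]
  refine Finset.sum_subset (fun y hy => ?_) fun y hy hyh => ?_
  · simp only [Finset.mem_filter, Finset.mem_univ, true_and] at hy ⊢
    exact hy.trans hh.2.1
  · simp only [Finset.mem_filter, Finset.mem_univ, true_and] at hy hyh
    split_ifs with hiy
    · rw [dividend_sup_eq_zero hv hadd y (y ⊓ h) (y \ h) ?_ ?_ ?_ (sup_inf_sdiff y h), mul_zero]
      · obtain ⟨j, hj⟩ := mem_players.1 hiy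
        exact SimpleGraph.ne_bot_iff_exists_adj.2 ⟨i, j, hj, hh.2.2.2 i hi j (hy hj)⟩
      · rwa [Ne, sdiff_eq_bot_iff]
      · refine Finset.disjoint_left.2 fun k hk hk' => ?_
        obtain ⟨l, hl⟩ := mem_players.1 hk'
        rw [SimpleGraph.sdiff_adj] at hl
        exact hl.2 (hh.2.2.2 k (players_mono inf_le_right hk) l (hy hl.1))
    · rfl

theorem sum_weightedMyerson_isComponent (w : N → ℝ) {v : SimpleGraph N → ℝ}
    (hv : IsValueFunction v) (hadd : IsComponentAdditive v) (g : SimpleGraph N) :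
    ∑ h : {h // IsComponent g h}, weightedMyerson w h.1 v = weightedMyerson w g v := by
  funext i
  rw [Finset.sum_apply]
  by_cases hi : i ∈ players g
  · obtain ⟨h, hh, hih⟩ := exists_isComponent hi
    rw [Finset.sum_eq_single ⟨h, hh⟩]
    · exact weightedMyerson_isComponent w hv hadd hh hih
    · exact fun h' _ hne => weightedMyerson_of_notMem w v fun hi' =>
        hne (Subtype.ext (h'.2.eq_of_mem hh hi' hih))
    · exact fun h' => absurd (Finset.mem_univ _) h'
  · rw [weightedMyerson_of_notMem w v hi]
    exact Finset.sum_eq_zero fun h _ => weightedMyerson_of_notMem w v fun hi' =>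
      hi (players_mono h.2.2.1 hi')

/-- Peel off a leaf `j` of the star: its only link is `ij`, so zero-monotonicity bounds `v x` below
by the value of a smaller star plus that of a single link. -/
theorem IsZeroMonotonic.nonneg_of_star {g : SimpleGraph N} {v : SimpleGraph N → ℝ}
    (hv : IsValueFunction v) (hzero : IsZeroMonotonic g v)
    (hlink : ∀ i j, g.Adj i j → 0 ≤ v (singleLink i j)) (i : N) (x : SimpleGraph N) :
    x ≤ g → (∀ a b, x.Adj a b → a = i ∨ b = i) → 0 ≤ v x := by
  induction x using WellFoundedLT.induction with
  | _ x ih =>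
    intro hx hstar
    rcases eq_or_ne x ⊥ with rfl | hne
    · exact hv.ge
    obtain ⟨j, hij⟩ : ∃ j, x.Adj i j := by
      obtain ⟨a, b, hab⟩ := SimpleGraph.ne_bot_iff_exists_adj.1 hne
      rcases hstar a b hab with rfl | rfl
      · exact ⟨b, hab⟩
      · exact ⟨a, hab.symm⟩
    have hj : j ∈ players x := mem_players.2 ⟨i, hij.symm⟩
    have hlinks : linksOf x j = singleLink i j := by
      ext a b
      have hne := hij.ne
      simp only [linksOf, singleLink, SimpleGraph.fromEdgeSet_adj, Set.mem_singleton_iff,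
        Sym2.eq_iff]
      constructor
      · rintro ⟨hab, h⟩
        have := hstar a b hab
        have := hab.ne
        grind
      · rintro ⟨⟨rfl, rfl⟩ | ⟨rfl, rfl⟩, _⟩
        · exact ⟨hij, Or.inr rfl⟩
        · exact ⟨hij.symm, Or.inl rfl⟩
    have h1 := hzero x hx j hj
    have h2 := ih _ (deleteLinksOf_lt hj) (sdiff_le.trans hx)
      fun a b hab => hstar a b (deleteLinksOf_adj.1 hab).1
    have h3 := hlink i j (hx hij)
    rw [hlinks] at h1
    linarith

end Networks

/-! ### Equilibrium of the mechanism -/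

theorem hasEquilibrium_mechanism {N : Type} [Fintype N] [LinearOrder N] {w : N → ℝ}
    (hw : ∀ i, 0 < w i) {v : SimpleGraph N → ℝ} (hv : IsValueFunction v)
    (hadd : IsComponentAdditive v) (g : SimpleGraph N) :
    IsZeroMonotonic g v → (∀ i j, g.Adj i j → 0 ≤ v (singleLink i j)) →
      HasEquilibrium (mechanism w v g) (weightedMyerson w g v) True := by
  induction g using WellFoundedLT.induction with
  | _ g ih =>
    intro hzero hlink
    rw [mechanism, ← sum_weightedMyerson_isComponent w hv hadd g]
    refine hasEquilibrium_parallel fun h => ?_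
    have hhg : h.1 ≤ g := h.2.2.1
    have hdel : ∀ p, deleteLinksOf h.1 p ≤ g := fun p => sdiff_le.trans hhg
    refine hasEquilibrium_biddingRound hw h.2.players_nonempty
      (z := fun p => weightedMyerson w (deleteLinksOf h.1 p.1) v) (fun p => ?_)
      (fun p => weightedMyerson_of_notMem w v (notMem_players_deleteLinksOf _ _)) (fun p => ?_)
      (fun p q => weightedMyerson_balanced w h.1 v p.1 q.1)
      (sum_weightedMyerson hw hv subset_rfl) fun j hj => weightedMyerson_of_notMem w v hj
    · exact ih _ ((deleteLinksOf_lt p.2).trans_le hhg)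
        (fun x hx => hzero x (hx.trans (hdel p.1))) fun i j hij => hlink i j (hdel p.1 hij)
    -- Players isolated by the deletion have value zero, so the continuation payoffs of the others
    -- sum to the value of the reduced network.
    · have hsub : players (deleteLinksOf h.1 p.1) ⊆ others h.1 p.1 := by
        refine Finset.subset_erase.2 ⟨players_mono sdiff_le, notMem_players_deleteLinksOf _ _⟩
      rw [sum_weightedMyerson hw hv hsub]
      have h1 := hzero h.1 hhg p.1 p.2
      have h2 := hzero.nonneg_of_star hv hlink p.1 (linksOf h.1 p.1)
        (fun a b hab => hhg hab.1) fun a b hab => hab.2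
      linarith

end NetworkGame

theorem mainTheorem6 {N : Type} [Fintype N] [LinearOrder N]
    (w : N → ℝ) (hw : ∀ i, 0 < w i)
    (g : SimpleGraph N) (v : SimpleGraph N → ℝ)
    (hv : NetworkGame.IsValueFunction v)
    (hadd : NetworkGame.IsComponentAdditive v)
    (hzero : NetworkGame.IsZeroMonotonic g v)
    (hlink : ∀ i j, g.Adj i j → 0 ≤ v (NetworkGame.singleLink i j)) :
    ∃ σ : (NetworkGame.mechanism w v g).Profile,
      (NetworkGame.mechanism w v g).IsSubgamePerfect σ ∧
      (∀ i, (NetworkGame.mechanism w v g).payoff σ i = NetworkGame.weightedMyerson w g v i) ∧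
      ∀ u, (NetworkGame.mechanism w v g).Realizes σ u → u = NetworkGame.weightedMyerson w g v := by
  obtain ⟨σ, h1, h2, h3⟩ := NetworkGame.hasEquilibrium_mechanism hw hv hadd g hzero hlink
  exact ⟨σ, h1, fun i => congrFun h2 i, h3 trivial⟩
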